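/- **Theorem 1.2 (Extension problem for the logarithmic discrete Laplacian operator).** For $n\in\mathbb Z$ let $(\Delta_d f)(n)=f(n+1)-2f(n)+f(n-1)$. For $u>0$ and $m\in\mathbb Z$ let $p_u(m)=e^{-2u}I_{|m|}(2u)$ be the discrete heat kernel, where $I_k(x)=\sum_{j\ge 0}\frac{(x/2)^{2j+k}}{j!\,(j+k)!}$ is the modified Bessel function of the first kind, and put $p_u(f)(n)=\sum_{m\in\mathbb Z}p_u(n-m)f(m)$. Let $f:\mathbb Z\to\mathbb R$ satisfy $\sum_{m\in\mathbb Z}\frac{|f(m)|}{\sqrt{1+|m|}}<\infty$. For such $f$ the logarithmic discrete Laplacian is defined by $$(\log(-\Delta_d)f)(n)=\sum_{m\in\mathbb Z,\,m\ne n}W_0(n-m)\,(f(n)-f(m))-\sum_{m\in\mathbb Z}W_\infty(n-m)f(m)-\gamma f(n),\quad n\in\mathbb Z,$$ where $\gamma$ is the Euler--Mascheroni constant, $W_0(m)=\int_0^1\frac{p_t(m)}{t}\,dt$ for $m\neq 0$, and $W_\infty(m)=\int_1^\infty\frac{p_t(m)}{t}\,dt$ for $m\in\mathbb Z$; put also $$u_f(n,t)=\int_0^\infty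 p_u(f)(n)\,\frac{e^{-t^2/(4u)}}{u}\,du,\qquad n\in\mathbb Z,\ t>0.$$ All these series and integrals converge absolutely, $u_f(n,\cdot)$ is twice differentiable on $(0,\infty)$, and for every $n\in\mathbb Z$: (i) $\lim_{t\to\infty}u_f(n,t)=0$; (ii) $\big(\partial_t^2+\frac1t\partial_t+\Delta_d\big)u_f(n,t)=0$ for every $t>0$; (iii) $\lim_{t\to0^+}t\,\partial_tu_f(n,t)=-2f(n)$; (iv) $\lim_{t\to0^+}\frac{u_f(n,t)}{\log t}=-2f(n)$; (v) the limit $\lim_{t\to0^+}\big(u_f(n,t)+2f(n)\log t\big)$ exists in $\mathbb R$ and $$(\log(-\Delta_d)f)(n)=-\lim_{t\to0^+}\big(u_f(n,t)+2f(n)\log t\big)+K f(n),$$ where $K=-\gamma+\int_{1/4}^\infty\frac{e^{-v}}{v}\,dv-\int_0^{1/4}\frac{1-e^{-v}}{v}\,dv$. -/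

import Mathlib

open MeasureTheory Set Filter Topology

noncomputable section

namespace DiscreteLog

/-- The modified Bessel function of the first kind `I_k(x)` of nonnegative integer order `k`:
`I_k(x) = ∑_{j ≥ 0} (x/2)^(2j+k) / (j! (j+k)!)`. -/
def besselI (k : ℕ) (x : ℝ) : ℝ :=
  ∑' j : ℕ, (x / 2) ^ (2 * j + k) / ((j.factorial : ℝ) * ((j + k).factorial : ℝ))

/-- The heat kernel on `ℤ`: `p_u(m) = e^{-2u} I_{|m|}(2u)`. -/
def heatKernel (u : ℝ) (m : ℤ) : ℝ :=
  Real.exp (-2 * u) * besselI m.natAbs (2 * u)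

/-- `p_u(f)(n) = ∑_{m ∈ ℤ} p_u(n - m) f(m)`. -/
def heat (u : ℝ) (f : ℤ → ℝ) (n : ℤ) : ℝ :=
  ∑' m : ℤ, heatKernel u (n - m) * f m

/-- The discrete Laplacian `(Δ_d f)(n) = f(n+1) - 2 f(n) + f(n-1)`. -/
def discreteLaplacian (f : ℤ → ℝ) (n : ℤ) : ℝ :=
  f (n + 1) - 2 * f n + f (n - 1)

/-- `W_0(m) = ∫_0^1 p_t(m)/t dt` (finite for `m ≠ 0`, which are the only values used). -/
def kernelZero (m : ℤ) : ℝ :=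
  ∫ t in Ioc (0 : ℝ) 1, heatKernel t m / t

/-- `W_∞(m) = ∫_1^∞ p_t(m)/t dt`. -/
def kernelInfty (m : ℤ) : ℝ :=
  ∫ t in Ioi (1 : ℝ), heatKernel t m / t

/-- The logarithmic discrete Laplacian
`(log(-Δ_d) f)(n) = ∑_{m ≠ n} W_0(n-m) (f(n) - f(m)) - ∑_m W_∞(n-m) f(m) - γ f(n)`. -/
def logDiscreteLaplacian (f : ℤ → ℝ) (n : ℤ) : ℝ :=
  (∑' m : {m : ℤ // m ≠ n}, kernelZero (n - m) * (f n - f m))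
    - (∑' m : ℤ, kernelInfty (n - m) * f m)
    - Real.eulerMascheroniConstant * f n

/-- The integrand in `u` of the extension `u_f(n,t)`. -/
def extensionIntegrand (f : ℤ → ℝ) (n : ℤ) (t u : ℝ) : ℝ :=
  heat u f n * (Real.exp (-(t ^ 2 / (4 * u))) / u)

/-- The extension `u_f(n,t) = ∫_0^∞ p_u(f)(n) e^{-t²/(4u)}/u du`. -/
def extension (f : ℤ → ℝ) (n : ℤ) (t : ℝ) : ℝ :=
  ∫ u in Ioi (0 : ℝ), extensionIntegrand f n t u

/-- `K = -γ + ∫_{1/4}^∞ e^{-v}/v dv - ∫_0^{1/4} (1 - e^{-v})/v dv`. -/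
def constK : ℝ :=
  -Real.eulerMascheroniConstant
    + (∫ v in Ioi (1 / 4 : ℝ), Real.exp (-v) / v)
    - ∫ v in Ioc (0 : ℝ) (1 / 4), (1 - Real.exp (-v)) / v

end DiscreteLog

end

/-!
Three facts about the heat kernel carry the proof: the recurrence
`m p_u(m) = u (p_u(m - 1) - p_u(m + 1))`, the heat equation, and the total mass one. The recurrence
makes `p_u` decrease along each parity class, so that `(1 + |m|) p_u(m) ≤ 1` and `m² p_u(m) ≤ u`;
with the heat equation it also gives `W_∞(m) ≤ 1 / |m|`. Hence `h(u) = p_u(f)(n)` is bounded,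
differs from `f(n)` by `O(u)` near zero, and is integrable against `du / u` at infinity.

The extension is the integral of `h` against `e^{-t²/(4u)} / u`, and differentiation in `t` only
raises the power of `u` in this kernel. The equation (ii) is then an integration by parts in `u`
combined with the heat equation, and (iii) follows from the substitution `v = t² / (4u)`. On
`(0, 1]` write `h = f(n) + (h - f(n))`: as `t → 0` the second part and the tail `u > 1` converge to
the integrals defining `log(-Δ_d) f`, whereas the first gives `f(n)` times an exponential integral,
whose expansion at zero produces the logarithm and the constant `K`. This is (v), and (iv) is a
consequence.
-/

namespace DiscreteLog

/-! ### The Bessel functions -/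

/-- The `j`-th term of the power series of `I_k`. -/
noncomputable def besselTerm (k j : ℕ) (x : ℝ) : ℝ :=
  (x / 2) ^ (2 * j + k) / ((j.factorial : ℝ) * ((j + k).factorial : ℝ))

lemma besselTerm_eq_mul (k j : ℕ) (x : ℝ) :
    besselTerm k j x =
      (x / 2) ^ (j + k) / ((j + k).factorial : ℝ) * ((x / 2) ^ j / (j.factorial : ℝ)) := by
  rw [besselTerm, div_mul_div_comm, ← pow_add, mul_comm ((j + k).factorial : ℝ)]
  ring_nf

lemma summable_exp_mul_exp (x y : ℝ) :
    Summable fun i : ℕ × ℕ =>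
      x ^ i.1 / (i.1.factorial : ℝ) * (y ^ i.2 / (i.2.factorial : ℝ)) :=
  summable_mul_of_summable_norm (Real.summable_pow_div_factorial x).norm
    (Real.summable_pow_div_factorial y).norm

lemma hasSum_besselTerm (k : ℕ) (x : ℝ) : HasSum (besselTerm k · x) (besselI k x) := by
  have hinj : Function.Injective fun j : ℕ => (j + k, j) := fun _ _ h => (Prod.ext_iff.1 h).2
  refine (((summable_exp_mul_exp (x / 2) (x / 2)).comp_injective hinj).congr fun j => ?_).hasSum
  exact (besselTerm_eq_mul k j x).symm

lemma besselI_nonneg (k : ℕ) {x : ℝ} (hx : 0 ≤ x) : 0 ≤ besselI k x :=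
  tsum_nonneg fun _ => by positivity

/-- Pairs of natural numbers are parametrized by their difference and their minimum;
this turns the double series of `e^{x/2} e^{x/2}` into the Bessel series of all orders. -/
def subMinEquiv : ℤ × ℕ ≃ ℕ × ℕ where
  toFun x := (x.2 + x.1.toNat, x.2 + (-x.1).toNat)
  invFun y := ((y.1 : ℤ) - y.2, min y.1 y.2)
  left_inv x := by
    obtain ⟨m, j⟩ := x
    simp only [Prod.mk.injEq]
    constructor <;> omega
  right_inv y := by
    ext <;> simp <;> omega

lemma besselTerm_natAbs (m : ℤ) (j : ℕ) (x : ℝ) :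
    besselTerm m.natAbs j x =
      (x / 2) ^ (subMinEquiv (m, j)).1 / ((subMinEquiv (m, j)).1.factorial : ℝ) *
        ((x / 2) ^ (subMinEquiv (m, j)).2 / ((subMinEquiv (m, j)).2.factorial : ℝ)) := by
  rw [besselTerm_eq_mul]
  rcases le_total 0 m with h | h
  · have h₁ : m.toNat = m.natAbs := by omega
    have h₂ : (-m).toNat = 0 := by omega
    simp [subMinEquiv, h₁, h₂]
  · have h₁ : m.toNat = 0 := by omega
    have h₂ : (-m).toNat = m.natAbs := by omega
    simp [subMinEquiv, h₁, h₂, mul_comm]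

lemma hasSum_besselI (x : ℝ) : HasSum (fun m : ℤ => besselI m.natAbs x) (Real.exp x) := by
  have hexp : HasSum (fun n : ℕ => (x / 2) ^ n / (n.factorial : ℝ)) (Real.exp (x / 2)) := by
    simpa only [Real.exp_eq_exp_ℝ] using NormedSpace.expSeries_div_hasSum_exp (x / 2)
  have hmul := hexp.mul hexp (summable_exp_mul_exp _ _)
  rw [← Real.exp_add, add_halves] at hmul
  refine HasSum.prod_fiberwise (subMinEquiv.hasSum_iff.2 hmul) fun m => ?_
  simp only [Function.comp_apply, ← besselTerm_natAbs]
  exact hasSum_besselTerm _ _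

lemma hasSum_besselI_succ (k : ℕ) (x : ℝ) :
    HasSum (fun j : ℕ =>
        (j : ℝ) * ((x / 2) ^ (2 * j + k - 1) / ((j.factorial : ℝ) * ((j + k).factorial : ℝ))))
      (besselI (k + 1) x) := by
  refine (hasSum_nat_add_iff' 1).1 ?_
  simp only [Finset.range_one, Finset.sum_singleton, Nat.cast_zero, zero_mul, sub_zero]
  refine (hasSum_besselTerm (k + 1) x).congr_fun fun j => ?_
  rw [besselTerm, show 2 * (j + 1) + k - 1 = 2 * j + (k + 1) by omega,
    show j + 1 + k = j + (k + 1) by ring, Nat.factorial_succ j]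
  push_cast
  field_simp

lemma hasSum_besselI_pred (k : ℕ) (x : ℝ) :
    HasSum (fun j : ℕ =>
        ((j : ℝ) + k) *
          ((x / 2) ^ (2 * j + k - 1) / ((j.factorial : ℝ) * ((j + k).factorial : ℝ))))
      (besselI ((k : ℤ) - 1).natAbs x) := by
  cases k with
  | zero => simpa using hasSum_besselI_succ 0 x
  | succ k =>
    rw [show (((k + 1 : ℕ) : ℤ) - 1).natAbs = k by omega]
    refine (hasSum_besselTerm k x).congr_fun fun j => ?_
    rw [besselTerm, show 2 * j + (k + 1) - 1 = 2 * j + k by omega, ← add_assoc j k 1,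
      Nat.factorial_succ (j + k)]
    push_cast
    field_simp
    ring

lemma mul_besselI (k : ℕ) (x : ℝ) :
    k * besselI k x = x / 2 * (besselI ((k : ℤ) - 1).natAbs x - besselI (k + 1) x) := by
  refine ((hasSum_besselTerm k x).mul_left (k : ℝ)).unique ?_
  refine (((hasSum_besselI_pred k x).sub (hasSum_besselI_succ k x)).mul_left (x / 2)).congr_fun
    fun j => ?_
  rcases Nat.eq_zero_or_pos (2 * j + k) with h | h
  · simp [show k = 0 by omega]
  · rw [besselTerm, ← Nat.sub_add_cancel h, pow_succ, Nat.sub_add_cancel h]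
    ring

lemma hasDerivAt_besselI (k : ℕ) (x : ℝ) :
    HasDerivAt (besselI k) ((besselI ((k : ℤ) - 1).natAbs x + besselI (k + 1) x) / 2) x := by
  set g' : ℕ → ℝ → ℝ := fun j y =>
    (2 * j + k : ℕ) * (y / 2) ^ (2 * j + k - 1) * 2⁻¹ /
      ((j.factorial : ℝ) * ((j + k).factorial : ℝ))
  have hg' (y : ℝ) :
      HasSum (g' · y) ((besselI ((k : ℤ) - 1).natAbs y + besselI (k + 1) y) / 2) := by
    refine (((hasSum_besselI_pred k y).add (hasSum_besselI_succ k y)).div_const 2).congr_fun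
      fun j => ?_
    simp only [g']
    push_cast
    ring
  rw [← (hg' x).tsum_eq]
  set R := |x| + 1
  have hx : x ∈ Ioo (-R) R := abs_lt.1 (lt_add_one |x|)
  refine hasDerivAt_tsum_of_isPreconnected (hg' R).summable isOpen_Ioo isPreconnected_Ioo
    (fun j y _ => ?_) (fun j y hy => ?_) hx (hasSum_besselTerm k x).summable hx
  · exact (((hasDerivAt_id y).div_const 2).pow _).div_const _ |>.congr_deriv (by simp [g'])
  · have hyR : |y| ≤ R := (abs_lt.2 hy).le
    simp only [g', norm_div, norm_mul, norm_pow, Real.norm_eq_abs, Nat.abs_cast, abs_inv,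
      abs_two]
    gcongr

/-! ### The heat kernel -/

lemma heatKernel_neg (u : ℝ) (m : ℤ) : heatKernel u (-m) = heatKernel u m := by
  rw [heatKernel, heatKernel, Int.natAbs_neg]

lemma heatKernel_nonneg {u : ℝ} (hu : 0 ≤ u) (m : ℤ) : 0 ≤ heatKernel u m :=
  mul_nonneg (Real.exp_pos _).le (besselI_nonneg _ (by positivity))

lemma hasSum_heatKernel (u : ℝ) : HasSum (heatKernel u) 1 := by
  have h := (hasSum_besselI (2 * u)).mul_left (Real.exp (-2 * u))
  rwa [← Real.exp_add, show -2 * u + 2 * u = 0 by ring, Real.exp_zero] at h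

lemma sum_heatKernel_le_one {u : ℝ} (hu : 0 ≤ u) (s : Finset ℕ) {e : ℕ → ℤ}
    (he : Function.Injective e) : ∑ i ∈ s, heatKernel u (e i) ≤ 1 := by
  have h := sum_le_hasSum (s.map ⟨e, he⟩) (fun m _ => heatKernel_nonneg hu m)
    (hasSum_heatKernel u)
  rwa [Finset.sum_map] at h

lemma mul_heatKernel (u : ℝ) (m : ℤ) :
    m * heatKernel u m = u * (heatKernel u (m - 1) - heatKernel u (m + 1)) := by
  have hnat (k : ℕ) : k * heatKernel u k = u * (heatKernel u (k - 1) - heatKernel u (k + 1)) := by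
    have h := mul_besselI k (2 * u)
    simp only [heatKernel, Int.natAbs_natCast, show ((k : ℤ) + 1).natAbs = k + 1 by omega]
    linear_combination Real.exp (-2 * u) * h
  obtain ⟨k, rfl | rfl⟩ := m.eq_nat_or_neg
  · exact_mod_cast hnat k
  · rw [show -(k : ℤ) - 1 = -(k + 1) by ring, show -(k : ℤ) + 1 = -(k - 1) by ring]
    simp only [heatKernel_neg]
    push_cast
    linear_combination -hnat k

lemma hasDerivAt_heatKernel (u : ℝ) (m : ℤ) :
    HasDerivAt (heatKernel · m) (discreteLaplacian (heatKernel u) m) u := by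
  have hnat (k : ℕ) : HasDerivAt (heatKernel · (k : ℤ)) (discreteLaplacian (heatKernel u) k) u := by
    have hexp : HasDerivAt (fun v : ℝ => Real.exp (-2 * v)) (Real.exp (-2 * u) * (-2)) u := by
      simpa using ((hasDerivAt_id u).const_mul (-2)).exp
    have hI := (hasDerivAt_besselI k (2 * u)).comp u ((hasDerivAt_id u).const_mul 2)
    refine (hexp.mul hI).congr_deriv ?_
    simp only [discreteLaplacian, heatKernel, Int.natAbs_natCast, Function.comp_apply,
      show ((k : ℤ) + 1).natAbs = k + 1 by omega]
    ring
  obtain ⟨k, rfl | rfl⟩ := m.eq_nat_or_neg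
  · exact hnat k
  · simp only [heatKernel_neg]
    refine (hnat k).congr_deriv ?_
    rw [discreteLaplacian, discreteLaplacian, show -(k : ℤ) - 1 = -(k + 1) by ring,
      show -(k : ℤ) + 1 = -(k - 1) by ring]
    simp only [heatKernel_neg]
    ring

lemma continuous_heatKernel (m : ℤ) : Continuous (heatKernel · m) :=
  continuous_iff_continuousAt.2 fun u => (hasDerivAt_heatKernel u m).continuousAt

/-! ### Decay of the heat kernel -/

lemma heatKernel_add_two_mul_le {u : ℝ} (hu : 0 < u) (k i : ℕ) :
    heatKernel u (k + 2 * i) ≤ heatKernel u k := by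
  induction i with
  | zero => simp
  | succ i ih =>
    refine le_trans ?_ ih
    have hrec := mul_heatKernel u (k + 2 * i + 1)
    rw [add_sub_cancel_right] at hrec
    have hmul : 0 ≤ u * (heatKernel u (k + 2 * i) - heatKernel u (k + 2 * i + 1 + 1)) :=
      hrec ▸ mul_nonneg (by norm_cast; positivity) (heatKernel_nonneg hu.le _)
    have h := nonneg_of_mul_nonneg_right hmul hu
    rw [show (k : ℤ) + 2 * (i + 1 : ℕ) = k + 2 * i + 1 + 1 by push_cast; ring]
    linarith

/-- The points `m, m - 2, …, -m` all carry at least the mass at `m`. -/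
lemma one_add_abs_mul_heatKernel_le {u : ℝ} (hu : 0 < u) (m : ℤ) :
    (1 + |(m : ℝ)|) * heatKernel u m ≤ 1 := by
  have hle (k i : ℕ) (hi : i ≤ k) : heatKernel u k ≤ heatKernel u (k - 2 * i) := by
    rcases le_total (2 * i) k with h | h
    · have := heatKernel_add_two_mul_le hu (k - 2 * i) i
      rwa [show ((k - 2 * i : ℕ) : ℤ) = k - 2 * i by omega, sub_add_cancel] at this
    · have := heatKernel_add_two_mul_le hu (2 * i - k) (k - i)
      rwa [show ((2 * i - k : ℕ) : ℤ) = -(k - 2 * i) by omega,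
        show -((k : ℤ) - 2 * i) + 2 * (k - i : ℕ) = k by omega, heatKernel_neg] at this
  have hnat (k : ℕ) : (1 + (k : ℝ)) * heatKernel u k ≤ 1 :=
    calc (1 + (k : ℝ)) * heatKernel u k
        = ∑ _i ∈ Finset.range (k + 1), heatKernel u k := by simp [add_comm]
      _ ≤ ∑ i ∈ Finset.range (k + 1), heatKernel u (k - 2 * i) :=
        Finset.sum_le_sum fun i hi => hle k i (Finset.mem_range_succ_iff.1 hi)
      _ ≤ 1 := sum_heatKernel_le_one hu.le _ fun i j hij => by simpa using hij
  obtain ⟨k, rfl | rfl⟩ := m.eq_nat_or_neg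
  · simpa using hnat k
  · simpa [heatKernel_neg] using hnat k

lemma sq_mul_heatKernel_le {u : ℝ} (hu : 0 < u) (m : ℤ) :
    (m : ℝ) ^ 2 * heatKernel u m ≤ u := by
  have hnat (k : ℕ) : (k : ℝ) ^ 2 * heatKernel u k ≤ u := by
    rcases k with _ | k
    · simpa using hu.le
    have hrec := mul_heatKernel u (k + 1)
    rw [add_sub_cancel_right] at hrec
    push_cast at hrec ⊢
    calc ((k : ℝ) + 1) ^ 2 * heatKernel u (k + 1)
        = u * ((1 + k) * (heatKernel u k - heatKernel u (k + 1 + 1))) := by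
          linear_combination ((k : ℝ) + 1) * hrec
      _ ≤ u * ((1 + k) * heatKernel u k) := by
          gcongr
          exact sub_le_self _ (heatKernel_nonneg hu.le _)
      _ ≤ u := mul_le_of_le_one_right hu.le (by simpa using one_add_abs_mul_heatKernel_le hu k)
  obtain ⟨k, rfl | rfl⟩ := m.eq_nat_or_neg
  · exact hnat k
  · simpa [heatKernel_neg] using hnat k

/-! ### The kernels of the logarithmic Laplacian -/

/-- The heat mass of the window `{1 - m, …, m}` leaks at the rate `p_u(m - 1) - p_u(m + 1)`, by
telescoping of the heat equation. -/
lemma hasDerivAt_sum_heatKernel {u : ℝ} (hu : 0 < u) (m : ℕ) :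
    HasDerivAt (fun v => ∑ i ∈ Finset.range (2 * m), heatKernel v (1 - m + i))
      (-(m * (heatKernel u m / u))) u := by
  refine (HasDerivAt.fun_sum (u := Finset.range (2 * m))
    fun i _ => hasDerivAt_heatKernel u (1 - m + i)).congr_deriv ?_
  set d : ℕ → ℝ := fun i => heatKernel u (1 - m + i) - heatKernel u (1 - m + i - 1)
  have hd (i : ℕ) : discreteLaplacian (heatKernel u) (1 - m + i) = d (i + 1) - d i := by
    simp only [discreteLaplacian, d, Nat.cast_succ, ← add_assoc, add_sub_cancel_right]
    ring
  have hrec : m * heatKernel u m = u * (heatKernel u (m - 1) - heatKernel u (m + 1)) := by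
    exact_mod_cast mul_heatKernel u m
  rw [Finset.sum_congr rfl fun i _ => hd i, Finset.sum_range_sub]
  simp only [d]
  rw [show 1 - (m : ℤ) + (2 * m : ℕ) = m + 1 by push_cast; ring, add_sub_cancel_right,
    show 1 - (m : ℤ) + (0 : ℕ) = -(m - 1) by push_cast; ring,
    show -((m : ℤ) - 1) - 1 = -m by ring, heatKernel_neg, heatKernel_neg]
  field_simp
  linear_combination hrec

lemma continuousOn_heatKernel_div (m : ℤ) :
    ContinuousOn (fun u => heatKernel u m / u) (Ioi 0) :=
  (continuous_heatKernel m).continuousOn.div continuousOn_id fun _ hu => hu.ne'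

lemma intervalIntegral_heatKernel_div_le (m : ℕ) {a b : ℝ} (ha : 0 < a) (hab : a ≤ b) :
    m * ∫ u in a..b, heatKernel u m / u ≤ 1 := by
  have hpos (u : ℝ) (hu : u ∈ uIcc a b) : 0 < u := ha.trans_le (uIcc_of_le hab ▸ hu).1
  have hint : IntervalIntegrable (fun u => -(m * (heatKernel u m / u))) volume a b :=
    (((continuousOn_heatKernel_div m).mono hpos).const_mul _).neg.intervalIntegrable
  have h := intervalIntegral.integral_eq_sub_of_hasDerivAt
    (fun u hu => hasDerivAt_sum_heatKernel (hpos u hu) m) hint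
  have hinj : Function.Injective fun i : ℕ => 1 - (m : ℤ) + i := fun i j hij => by simpa using hij
  have hle := sum_heatKernel_le_one ha.le (Finset.range (2 * m)) hinj
  have hnonneg : 0 ≤ ∑ i ∈ Finset.range (2 * m), heatKernel b (1 - m + i) :=
    Finset.sum_nonneg fun i _ => heatKernel_nonneg (ha.le.trans hab) _
  rw [intervalIntegral.integral_neg, intervalIntegral.integral_const_mul] at h
  linarith

lemma integrableOn_and_integral_Ioi_le_of_intervalIntegral_le {g : ℝ → ℝ} {a I : ℝ}
    (hg : ContinuousOn g (Ici a)) (hg₀ : ∀ x ∈ Ioi a, 0 ≤ g x)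
    (hI : ∀ b, a ≤ b → ∫ x in a..b, g x ≤ I) :
    IntegrableOn g (Ioi a) ∧ ∫ x in Ioi a, g x ≤ I := by
  have hint : IntegrableOn g (Ioi a) := by
    refine integrableOn_Ioi_of_intervalIntegral_norm_bounded I a
      (fun b => (hg.mono Icc_subset_Ici_self).integrableOn_Icc.mono_set Ioc_subset_Icc_self)
      tendsto_id ?_
    filter_upwards [eventually_ge_atTop a] with b hb
    refine (intervalIntegral.integral_congr_ae (ae_of_all _ fun x hx => ?_)).trans_le (hI b hb)
    exact Real.norm_of_nonneg (hg₀ x (uIoc_of_le hb ▸ hx).1)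
  refine ⟨hint, le_of_tendsto (intervalIntegral_tendsto_integral_Ioi a hint tendsto_id) ?_⟩
  filter_upwards [eventually_ge_atTop a] with b hb using hI b hb

lemma integrableOn_and_kernelInfty_le_of_pos {m : ℕ} (hm : 0 < m) :
    IntegrableOn (fun u => heatKernel u m / u) (Ioi 1) ∧ kernelInfty m ≤ 1 / m := by
  refine integrableOn_and_integral_Ioi_le_of_intervalIntegral_le
    ((continuousOn_heatKernel_div m).mono (Ici_subset_Ioi.2 one_pos))
    (fun u hu => ?_) fun b hb => ?_
  · have hu₀ : 0 ≤ u := zero_le_one.trans (mem_Ioi.1 hu).le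
    exact div_nonneg (heatKernel_nonneg hu₀ _) hu₀
  · rw [le_div_iff₀' (by exact_mod_cast hm)]
    exact intervalIntegral_heatKernel_div_le m one_pos hb

lemma heatKernel_zero_div_le {u : ℝ} (hu : 1 ≤ u) :
    heatKernel u 0 / u ≤ heatKernel u 1 / u + heatKernel u 2 / u := by
  have hrec := mul_heatKernel u 1
  norm_num at hrec
  have hdiff : heatKernel u 0 - heatKernel u 2 ≤ heatKernel u 1 := by
    have := heatKernel_nonneg (zero_le_one.trans hu) 1
    nlinarith
  rw [← add_div]
  gcongr
  linarith

lemma integrableOn_and_kernelInfty_zero_le :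
    IntegrableOn (fun u => heatKernel u 0 / u) (Ioi 1) ∧ kernelInfty 0 ≤ 3 / 2 := by
  obtain ⟨hint₁, hle₁⟩ := integrableOn_and_kernelInfty_le_of_pos one_pos
  obtain ⟨hint₂, hle₂⟩ := integrableOn_and_kernelInfty_le_of_pos two_pos
  have hbound (u : ℝ) (hu : u ∈ Ioi (1 : ℝ)) := heatKernel_zero_div_le (mem_Ioi.1 hu).le
  have hint : IntegrableOn (fun u => heatKernel u 0 / u) (Ioi 1) := by
    refine Integrable.mono' (hint₁.add hint₂) (((continuousOn_heatKernel_div 0).mono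
      (Ioi_subset_Ioi zero_le_one)).aestronglyMeasurable measurableSet_Ioi)
      (ae_restrict_of_forall_mem measurableSet_Ioi fun u hu => ?_)
    have hu₀ : 0 ≤ u := zero_le_one.trans (mem_Ioi.1 hu).le
    rw [Real.norm_of_nonneg (div_nonneg (heatKernel_nonneg hu₀ 0) hu₀)]
    exact hbound u hu
  refine ⟨hint, ?_⟩
  calc kernelInfty 0
      ≤ ∫ u in Ioi 1, (heatKernel u (1 : ℕ) / u + heatKernel u (2 : ℕ) / u) :=
        setIntegral_mono_on hint (hint₁.add hint₂) measurableSet_Ioi hbound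
    _ = kernelInfty (1 : ℕ) + kernelInfty (2 : ℕ) := integral_add hint₁ hint₂
    _ ≤ 1 / (1 : ℕ) + 1 / (2 : ℕ) := add_le_add hle₁ hle₂
    _ = 3 / 2 := by norm_num

lemma kernelInfty_neg (m : ℤ) : kernelInfty (-m) = kernelInfty m := by
  simp only [kernelInfty, heatKernel_neg]

lemma kernelInfty_nonneg (m : ℤ) : 0 ≤ kernelInfty m :=
  setIntegral_nonneg measurableSet_Ioi fun u hu =>
    have hu₀ : 0 ≤ u := zero_le_one.trans (mem_Ioi.1 hu).le
    div_nonneg (heatKernel_nonneg hu₀ m) hu₀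

lemma integrableOn_heatKernel_div_Ioi (m : ℤ) :
    IntegrableOn (fun u => heatKernel u m / u) (Ioi 1) := by
  have hnat (k : ℕ) : IntegrableOn (fun u => heatKernel u k / u) (Ioi 1) := by
    rcases k.eq_zero_or_pos with rfl | hk
    · exact integrableOn_and_kernelInfty_zero_le.1
    · exact (integrableOn_and_kernelInfty_le_of_pos hk).1
  obtain ⟨k, rfl | rfl⟩ := m.eq_nat_or_neg
  · exact hnat k
  · simpa only [heatKernel_neg] using hnat k

lemma one_add_abs_mul_kernelInfty_le (m : ℤ) : (1 + |(m : ℝ)|) * kernelInfty m ≤ 2 := by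
  have hnat (k : ℕ) : (1 + (k : ℝ)) * kernelInfty k ≤ 2 := by
    rcases k.eq_zero_or_pos with rfl | hk
    · have := integrableOn_and_kernelInfty_zero_le.2
      norm_num
      linarith
    · have hk' : (1 : ℝ) ≤ k := by exact_mod_cast hk
      calc (1 + (k : ℝ)) * kernelInfty k ≤ (k + k) * (1 / k) := by
            gcongr
            exacts [kernelInfty_nonneg k, (integrableOn_and_kernelInfty_le_of_pos hk).2]
        _ = 2 := by field_simp; norm_num
  obtain ⟨k, rfl | rfl⟩ := m.eq_nat_or_neg
  · simpa using hnat k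
  · simpa [kernelInfty_neg] using hnat k

lemma integrableOn_div_Ioc_of_abs_le {h : ℝ → ℝ} {D : ℝ} (hc : ContinuousOn h (Ioi 0))
    (hD : ∀ u, 0 < u → |h u| ≤ D * u) : IntegrableOn (fun u => h u / u) (Ioc 0 1) := by
  refine IntegrableOn.of_bound (C := D) (by simp)
    (((hc.div continuousOn_id fun u hu => hu.ne').mono
      Ioc_subset_Ioi_self).aestronglyMeasurable measurableSet_Ioc)
    (ae_restrict_of_forall_mem measurableSet_Ioc fun u hu => ?_)
  rw [norm_div, Real.norm_of_nonneg hu.1.le, div_le_iff₀ hu.1]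
  exact hD u hu.1

lemma integrableOn_heatKernel_div_Ioc {m : ℤ} (hm : m ≠ 0) :
    IntegrableOn (fun u => heatKernel u m / u) (Ioc 0 1) := by
  have hm' : 1 ≤ (m : ℝ) ^ 2 := by
    exact_mod_cast (one_le_sq_iff_one_le_abs m).2 (Int.one_le_abs hm)
  refine integrableOn_div_Ioc_of_abs_le (D := 1) (continuous_heatKernel m).continuousOn
    fun u hu => ?_
  have hp := heatKernel_nonneg hu.le m
  rw [abs_of_nonneg hp, one_mul]
  exact (le_mul_of_one_le_left hp hm').trans (sq_mul_heatKernel_le hu m)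

/-! ### The heat semigroup -/

lemma one_add_abs_le_mul (n m : ℤ) :
    1 + |(m : ℝ)| ≤ (1 + |(n : ℝ)|) * (1 + |((n - m : ℤ) : ℝ)|) := by
  have h : |(m : ℝ)| ≤ |(n : ℝ)| + |((n - m : ℤ) : ℝ)| := by
    simpa using abs_sub (n : ℝ) ((n - m : ℤ) : ℝ)
  nlinarith [abs_nonneg (n : ℝ), abs_nonneg ((n - m : ℤ) : ℝ)]

lemma mul_abs_le_of_one_add_abs_mul_le (f : ℤ → ℝ) (n m : ℤ) {q c : ℝ} (hq : 0 ≤ q)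
    (h : (1 + |((n - m : ℤ) : ℝ)|) * q ≤ c) :
    q * |f m| ≤ c * ((1 + |(n : ℝ)|) * (|f m| / (1 + |(m : ℝ)|))) :=
  calc q * |f m| = (1 + |(m : ℝ)|) * q * (|f m| / (1 + |(m : ℝ)|)) := by field_simp
    _ ≤ (1 + |(n : ℝ)|) * (1 + |((n - m : ℤ) : ℝ)|) * q * (|f m| / (1 + |(m : ℝ)|)) := by
      gcongr
      exact one_add_abs_le_mul n m
    _ = (1 + |((n - m : ℤ) : ℝ)|) * q * ((1 + |(n : ℝ)|) * (|f m| / (1 + |(m : ℝ)|))) := by ring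
    _ ≤ c * ((1 + |(n : ℝ)|) * (|f m| / (1 + |(m : ℝ)|))) := by gcongr

lemma abs_heatKernel_mul_le (f : ℤ → ℝ) {u : ℝ} (hu : 0 < u) (n m : ℤ) :
    |heatKernel u (n - m) * f m| ≤ (1 + |(n : ℝ)|) * (|f m| / (1 + |(m : ℝ)|)) := by
  have hp := heatKernel_nonneg hu.le (n - m)
  rw [abs_mul, abs_of_nonneg hp]
  simpa using mul_abs_le_of_one_add_abs_mul_le f n m hp (one_add_abs_mul_heatKernel_le hu _)

/-- A bound, uniform in `u` and summable in `m`, for `p_u(n - m) (f(m) - f(n)) / u`. -/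
noncomputable def incrementBound (f : ℤ → ℝ) (n m : ℤ) : ℝ :=
  |f n| * (1 / ((n - m : ℤ) : ℝ) ^ 2) + 2 * ((1 + |(n : ℝ)|) * (|f m| / (1 + |(m : ℝ)|)))

lemma abs_heatKernel_mul_sub_le (f : ℤ → ℝ) {u : ℝ} (hu : 0 < u) (n m : ℤ) :
    |heatKernel u (n - m) * (f m - f n)| ≤ u * incrementBound f n m := by
  rcases eq_or_ne m n with rfl | hmn
  · rw [sub_self (f m), mul_zero, abs_zero, incrementBound]
    positivity
  have hp := heatKernel_nonneg hu.le (n - m)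
  have hsq := sq_mul_heatKernel_le hu (n - m)
  have hk : 1 ≤ |((n - m : ℤ) : ℝ)| := by
    exact_mod_cast Int.one_le_abs (sub_ne_zero.2 hmn.symm)
  have hfn : heatKernel u (n - m) * |f n| ≤ u * (|f n| * (1 / ((n - m : ℤ) : ℝ) ^ 2)) := by
    rw [← sq_abs] at hsq ⊢
    rw [mul_left_comm, mul_one_div, mul_comm]
    gcongr
    rwa [le_div_iff₀' (by positivity)]
  have hfm : heatKernel u (n - m) * |f m| ≤
      2 * u * ((1 + |(n : ℝ)|) * (|f m| / (1 + |(m : ℝ)|))) := by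
    have hk₂ : 1 + |((n - m : ℤ) : ℝ)| ≤ 2 * ((n - m : ℤ) : ℝ) ^ 2 := by
      rw [← sq_abs]
      nlinarith
    exact mul_abs_le_of_one_add_abs_mul_le f n m hp
      ((mul_le_mul_of_nonneg_right hk₂ hp).trans (by linarith))
  calc |heatKernel u (n - m) * (f m - f n)|
      ≤ heatKernel u (n - m) * (|f m| + |f n|) := by
        rw [abs_mul, abs_of_nonneg hp]
        gcongr
        exact abs_sub _ _
    _ ≤ u * incrementBound f n m := by
        rw [incrementBound]
        linarith

lemma integrable_of_hasSum {α ι : Type*} [MeasurableSpace α] [Countable ι] {μ : Measure α}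
    {F : ι → α → ℝ} {g : α → ℝ} (hF : ∀ i, Integrable (F i) μ)
    (hFs : Summable fun i => ∫ a, ‖F i a‖ ∂μ) (hg : AEStronglyMeasurable g μ)
    (h : ∀ᵐ a ∂μ, HasSum (F · a) (g a)) : Integrable g μ := by
  refine ⟨hg, lt_of_le_of_lt ?_ hFs.tsum_ofReal_lt_top⟩
  calc ∫⁻ a, ‖g a‖ₑ ∂μ ≤ ∫⁻ a, ∑' i, ‖F i a‖ₑ ∂μ :=
        lintegral_mono_ae (h.mono fun a ha => ha.tsum_eq ▸ enorm_tsum_le_tsum_enorm)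
    _ = ∑' i, ENNReal.ofReal (∫ a, ‖F i a‖ ∂μ) := by
        rw [lintegral_tsum fun i => (hF i).aestronglyMeasurable.enorm]
        exact tsum_congr fun i => (ofReal_integral_norm_eq_lintegral_enorm (hF i)).symm

section ModerateGrowth

variable {f : ℤ → ℝ} (hf : Summable fun m : ℤ => |f m| / (1 + |(m : ℝ)|))
include hf

lemma summable_incrementBound (n : ℤ) : Summable (incrementBound f n) := by
  have h : Summable fun k : ℤ => 1 / (k : ℝ) ^ 2 := Real.summable_one_div_int_pow.2 one_lt_two
  exact ((h.comp_injective (Equiv.subLeft n).injective).mul_left _).add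
    ((hf.mul_left _).mul_left _)

lemma summable_heatKernel_mul {u : ℝ} (hu : 0 < u) (n : ℤ) :
    Summable fun m : ℤ => heatKernel u (n - m) * f m :=
  (hf.mul_left (1 + |(n : ℝ)|)).of_norm_bounded fun m => abs_heatKernel_mul_le f hu n m

lemma hasSum_heat {u : ℝ} (hu : 0 < u) (n : ℤ) :
    HasSum (fun m : ℤ => heatKernel u (n - m) * f m) (heat u f n) :=
  (summable_heatKernel_mul hf hu n).hasSum

lemma exists_abs_heat_le (n : ℤ) : ∃ M : ℝ, ∀ u, 0 < u → |heat u f n| ≤ M :=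
  ⟨_, fun u hu => tsum_of_norm_bounded (f := fun m => heatKernel u (n - m) * f m)
    (hf.mul_left (1 + |(n : ℝ)|)).hasSum fun m => abs_heatKernel_mul_le f hu n m⟩

lemma hasSum_heat_sub {u : ℝ} (hu : 0 < u) (n : ℤ) :
    HasSum (fun m : ℤ => heatKernel u (n - m) * (f m - f n)) (heat u f n - f n) := by
  have hmass : HasSum (fun m : ℤ => heatKernel u (n - m)) 1 :=
    (Equiv.subLeft n).hasSum_iff.2 (hasSum_heatKernel u)
  simpa only [mul_sub, one_mul] using (hasSum_heat hf hu n).sub (hmass.mul_right (f n))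

lemma exists_abs_heat_sub_le (n : ℤ) : ∃ D : ℝ, ∀ u, 0 < u → |heat u f n - f n| ≤ D * u := by
  refine ⟨∑' m, incrementBound f n m, fun u hu => ?_⟩
  rw [← (hasSum_heat_sub hf hu n).tsum_eq, mul_comm]
  exact tsum_of_norm_bounded (f := fun m => heatKernel u (n - m) * (f m - f n))
    ((summable_incrementBound hf n).hasSum.mul_left u) fun m => abs_heatKernel_mul_sub_le f hu n m

lemma tendsto_heat_zero (n : ℤ) : Tendsto (fun u => heat u f n) (𝓝[>] 0) (𝓝 (f n)) := by
  obtain ⟨D, hD⟩ := exists_abs_heat_sub_le hf n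
  rw [tendsto_iff_norm_sub_tendsto_zero]
  have hlim : Tendsto (fun u : ℝ => D * u) (𝓝[>] 0) (𝓝 0) :=
    ((continuous_const_mul D).tendsto' 0 0 (mul_zero D)).mono_left nhdsWithin_le_nhds
  exact squeeze_zero' (Eventually.of_forall fun _ => norm_nonneg _)
    (eventually_mem_nhdsWithin.mono hD) hlim

omit hf in
lemma discreteLaplacian_heatKernel_sub_mul (u : ℝ) (n m : ℤ) :
    discreteLaplacian (heatKernel u) (n - m) * f m = heatKernel u (n + 1 - m) * f m
      - 2 * (heatKernel u (n - m) * f m) + heatKernel u (n - 1 - m) * f m := by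
  rw [discreteLaplacian, sub_add_eq_add_sub n m 1, show n - m - 1 = n - 1 - m by ring]
  ring

lemma hasSum_discreteLaplacian_heat {u : ℝ} (hu : 0 < u) (n : ℤ) :
    HasSum (fun m : ℤ => discreteLaplacian (heatKernel u) (n - m) * f m)
      (discreteLaplacian (heat u f) n) := by
  simp only [discreteLaplacian_heatKernel_sub_mul]
  exact ((hasSum_heat hf hu (n + 1)).sub ((hasSum_heat hf hu n).mul_left 2)).add
    (hasSum_heat hf hu (n - 1))

lemma hasDerivAt_heat {u : ℝ} (hu : 0 < u) (n : ℤ) :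
    HasDerivAt (fun v => heat v f n) (discreteLaplacian (heat u f) n) u := by
  rw [← (hasSum_discreteLaplacian_heat hf hu n).tsum_eq]
  refine hasDerivAt_tsum_of_isPreconnected (t := Ioi 0)
    (g := fun m v => heatKernel v (n - m) * f m)
    (hf.mul_left (1 + |((n + 1 : ℤ) : ℝ)| + 2 * (1 + |(n : ℝ)|) + (1 + |((n - 1 : ℤ) : ℝ)|)))
    isOpen_Ioi isPreconnected_Ioi (fun m v _ => (hasDerivAt_heatKernel v (n - m)).mul_const _)
    (fun m v hv => ?_) hu (summable_heatKernel_mul hf hu n) hu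
  have h₁ := abs_le.1 (abs_heatKernel_mul_le f hv (n + 1) m)
  have h₂ := abs_le.1 (abs_heatKernel_mul_le f hv n m)
  have h₃ := abs_le.1 (abs_heatKernel_mul_le f hv (n - 1) m)
  rw [discreteLaplacian_heatKernel_sub_mul, Real.norm_eq_abs, abs_le]
  constructor <;> linarith

lemma continuousOn_heat (n : ℤ) : ContinuousOn (fun u => heat u f n) (Ioi 0) :=
  fun _ hu => (hasDerivAt_heat hf hu n).continuousAt.continuousWithinAt

lemma hasSum_kernelZero (n : ℤ) :
    HasSum (fun m : ℤ => kernelZero (n - m) * (f n - f m))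
      (∫ u in Ioc 0 1, -((heat u f n - f n) / u)) := by
  set F : ℤ → ℝ → ℝ := fun m u => heatKernel u (n - m) / u * (f n - f m)
  have hF (m : ℤ) : IntegrableOn (F m) (Ioc 0 1) := by
    rcases eq_or_ne m n with rfl | hmn
    · simp [F]
    · exact (integrableOn_heatKernel_div_Ioc (sub_ne_zero.2 hmn.symm)).mul_const _
  have hbound (m : ℤ) (u : ℝ) (hu : u ∈ Ioc (0 : ℝ) 1) : ‖F m u‖ ≤ incrementBound f n m := by
    rw [show F m u = -(heatKernel u (n - m) * (f m - f n)) / u by simp only [F]; ring, norm_div,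
      norm_neg, Real.norm_of_nonneg hu.1.le, div_le_iff₀' hu.1]
    exact abs_heatKernel_mul_sub_le f hu.1 n m
  have hnorm (m : ℤ) : ∫ u in Ioc 0 1, ‖F m u‖ ≤ incrementBound f n m := by
    simpa using setIntegral_mono_on (hF m).norm (integrableOn_const (by simp)) measurableSet_Ioc
      (hbound m)
  have hsum := hasSum_integral_of_summable_integral_norm hF
    ((summable_incrementBound hf n).of_nonneg_of_le
      (fun m => integral_nonneg fun _ => norm_nonneg _) hnorm)
  rw [setIntegral_congr_fun measurableSet_Ioc (g := fun u => -((heat u f n - f n) / u))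
    fun u hu => ?_] at hsum
  · simpa only [F, kernelZero, integral_mul_const] using hsum
  · refine HasSum.tsum_eq ((((hasSum_heat_sub hf hu.1 n).div_const u).neg).congr_fun fun m => ?_)
    simp only [F]
    ring

lemma hasSum_heatKernel_div_mul {u : ℝ} (hu : 0 < u) (n : ℤ) :
    HasSum (fun m : ℤ => heatKernel u (n - m) / u * f m) (heat u f n / u) :=
  ((hasSum_heat hf hu n).div_const u).congr_fun fun _ => div_mul_eq_mul_div _ _ _

lemma summable_integral_norm_heatKernel_div_mul (n : ℤ) :
    Summable fun m : ℤ => ∫ u in Ioi 1, ‖heatKernel u (n - m) / u * f m‖ := by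
  refine ((hf.mul_left (1 + |(n : ℝ)|)).mul_left 2).of_nonneg_of_le
    (fun m => integral_nonneg fun _ => norm_nonneg _) fun m => ?_
  have heq : ∫ u in Ioi 1, ‖heatKernel u (n - m) / u * f m‖ = kernelInfty (n - m) * |f m| := by
    rw [kernelInfty, ← integral_mul_const]
    refine setIntegral_congr_fun measurableSet_Ioi fun u hu => ?_
    have hu₀ : 0 ≤ u := zero_le_one.trans (mem_Ioi.1 hu).le
    rw [norm_mul, Real.norm_of_nonneg (div_nonneg (heatKernel_nonneg hu₀ _) hu₀),
      Real.norm_eq_abs]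
  rw [heq]
  exact mul_abs_le_of_one_add_abs_mul_le f n m (kernelInfty_nonneg _)
    (one_add_abs_mul_kernelInfty_le _)

lemma hasSum_kernelInfty (n : ℤ) :
    HasSum (fun m : ℤ => kernelInfty (n - m) * f m) (∫ u in Ioi 1, heat u f n / u) := by
  have hsum := hasSum_integral_of_summable_integral_norm
    (fun m => (integrableOn_heatKernel_div_Ioi (n - m)).mul_const (f m))
    (summable_integral_norm_heatKernel_div_mul hf n)
  rw [setIntegral_congr_fun measurableSet_Ioi fun u hu =>
    (hasSum_heatKernel_div_mul hf (zero_lt_one.trans hu) n).tsum_eq] at hsum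
  simpa only [kernelInfty, integral_mul_const] using hsum

lemma integrableOn_heat_div_Ioi (n : ℤ) : IntegrableOn (fun u => heat u f n / u) (Ioi 1) := by
  refine integrable_of_hasSum (fun m => (integrableOn_heatKernel_div_Ioi (n - m)).mul_const (f m))
    (summable_integral_norm_heatKernel_div_mul hf n) ?_
    (ae_restrict_of_forall_mem measurableSet_Ioi fun u hu =>
      hasSum_heatKernel_div_mul hf (zero_lt_one.trans hu) n)
  have hc : ContinuousOn (fun u => heat u f n / u) (Ioi 0) :=
    (continuousOn_heat hf n).div continuousOn_id fun _ hu => hu.ne'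
  exact (hc.mono (Ioi_subset_Ioi zero_le_one)).aestronglyMeasurable measurableSet_Ioi

lemma logDiscreteLaplacian_eq_integral (n : ℤ) :
    logDiscreteLaplacian f n = -(∫ u in Ioc 0 1, (heat u f n - f n) / u)
      - (∫ u in Ioi 1, heat u f n / u) - Real.eulerMascheroniConstant * f n := by
  have hsub : ∑' m : {m : ℤ // m ≠ n}, kernelZero (n - m) * (f n - f m) =
      ∑' m : ℤ, kernelZero (n - m) * (f n - f m) :=
    tsum_subtype_eq_of_support_subset (s := {m : ℤ | m ≠ n})
      (f := fun m : ℤ => kernelZero (n - m) * (f n - f m)) fun m hm hmn => hm (by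
        simp [show m = n from hmn])
  rw [logDiscreteLaplacian, hsub, (hasSum_kernelZero hf n).tsum_eq,
    (hasSum_kernelInfty hf n).tsum_eq, integral_neg]

end ModerateGrowth

/-! ### Integrals against `e^{-t²/(4u)} / u^j` -/

/-- The kernel `e^{-t²/(4u)} / u^j`: the extension integrates against `j = 1`, and its
derivatives in `t` against `j = 2, 3`. -/
noncomputable def extensionKernel (j : ℕ) (t u : ℝ) : ℝ :=
  Real.exp (-(t ^ 2 / (4 * u))) / u ^ j

lemma extensionKernel_nonneg (j : ℕ) (t : ℝ) {u : ℝ} (hu : 0 < u) :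
    0 ≤ extensionKernel j t u := by
  rw [extensionKernel]
  positivity

lemma extensionKernel_eq_mul_succ (j : ℕ) (t : ℝ) {u : ℝ} (hu : 0 < u) :
    extensionKernel j t u = u * extensionKernel (j + 1) t u := by
  rw [extensionKernel, extensionKernel]
  field_simp
  ring

lemma extensionKernel_le_inv_pow (j : ℕ) (t : ℝ) {u : ℝ} (hu : 0 < u) :
    extensionKernel j t u ≤ (u ^ j)⁻¹ := by
  rw [extensionKernel, ← one_div]
  gcongr
  exact Real.exp_le_one_iff.2 (neg_nonpos.2 (by positivity))

lemma extensionKernel_one_le_inv (t : ℝ) {u : ℝ} (hu : 0 < u) :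
    extensionKernel 1 t u ≤ u⁻¹ := by
  simpa using extensionKernel_le_inv_pow 1 t hu

lemma extensionKernel_anti (j : ℕ) {s t u : ℝ} (hu : 0 < u) (hs : 0 ≤ s) (hst : s ≤ t) :
    extensionKernel j t u ≤ extensionKernel j s u := by
  rw [extensionKernel, extensionKernel]
  gcongr

lemma exists_extensionKernel_le (j : ℕ) {t : ℝ} (ht : 0 < t) :
    ∃ C : ℝ, ∀ u, 0 < u → extensionKernel j t u ≤ C := by
  refine ⟨j.factorial / (t ^ 2 / 4) ^ j, fun u hu => ?_⟩
  have hexp := Real.pow_div_factorial_le_exp (t ^ 2 / (4 * u)) (by positivity) j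
  have hpow : (t ^ 2 / 4) ^ j = (t ^ 2 / (4 * u)) ^ j * u ^ j := by
    rw [← mul_pow]
    congr 1
    field_simp
  rw [div_le_iff₀ (by positivity)] at hexp
  rw [extensionKernel, Real.exp_neg, div_le_div_iff₀ (by positivity) (by positivity), hpow,
    inv_mul_le_iff₀ (Real.exp_pos _), ← mul_assoc]
  gcongr

lemma continuousOn_extensionKernel (j : ℕ) (t : ℝ) :
    ContinuousOn (extensionKernel j t) (Ioi 0) := by
  have hexp : ContinuousOn (fun u : ℝ => t ^ 2 / (4 * u)) (Ioi 0) :=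
    continuousOn_const.div (by fun_prop) fun u hu => mul_ne_zero four_ne_zero hu.ne'
  exact hexp.neg.rexp.div (by fun_prop) fun u hu => pow_ne_zero _ hu.ne'

lemma hasDerivAt_extensionKernel_left (j : ℕ) (t u : ℝ) :
    HasDerivAt (fun s => extensionKernel j s u) (-(t / 2) * extensionKernel (j + 1) t u) t := by
  refine (((hasDerivAt_pow 2 t).div_const (4 * u)).neg.exp.div_const (u ^ j)).congr_deriv ?_
  rw [extensionKernel]
  rcases eq_or_ne u 0 with rfl | hu
  · simp
  · simp only [Pi.neg_apply]
    field_simp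
    ring

lemma hasDerivAt_const_div (c : ℝ) {u : ℝ} (hu : u ≠ 0) :
    HasDerivAt (fun v => c / v) (-(c / u ^ 2)) u := by
  simpa only [div_eq_mul_inv, mul_neg] using (hasDerivAt_inv hu).const_mul c

lemma hasDerivAt_extensionKernel_one (t : ℝ) {u : ℝ} (hu : 0 < u) :
    HasDerivAt (extensionKernel 1 t)
      (-extensionKernel 2 t u + t ^ 2 / 4 * extensionKernel 3 t u) u := by
  have hfun : extensionKernel 1 t = fun v => Real.exp (-(t ^ 2 / 4 / v)) / v := by
    funext v
    rw [extensionKernel, div_div, pow_one]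
  rw [hfun]
  refine ((hasDerivAt_const_div (t ^ 2 / 4) hu.ne').neg.exp.div
    (hasDerivAt_id u) hu.ne').congr_deriv ?_
  simp only [extensionKernel, Pi.neg_apply, id, ← div_div]
  field_simp
  ring

/-- Conditions on a profile `h` under which `∫ h(u) e^{-t²/(4u)} / u^j du` over `(0, ∞)` converges
absolutely for all `j ≥ 1` and `t > 0`; they are applied to `u ↦ p_u(f)(n)`. -/
structure IsAdmissible (h : ℝ → ℝ) : Prop where
  continuousOn : ContinuousOn h (Ioi 0)
  bounded : ∃ M : ℝ, ∀ u, 0 < u → |h u| ≤ M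
  integrableOn_div : IntegrableOn (fun u => h u / u) (Ioi 1)

lemma aestronglyMeasurable_mul_extensionKernel {h : ℝ → ℝ} (hc : ContinuousOn h (Ioi 0)) (j : ℕ)
    (t : ℝ) : AEStronglyMeasurable (fun u => h u * extensionKernel j t u)
      (volume.restrict (Ioi 0)) :=
  (hc.mul (continuousOn_extensionKernel j t)).aestronglyMeasurable measurableSet_Ioi

lemma integrableOn_mul_extensionKernel_Ioc {h : ℝ → ℝ} {M : ℝ} (hc : ContinuousOn h (Ioi 0))
    (hM : ∀ u, 0 < u → |h u| ≤ M) (j : ℕ) {t : ℝ} (ht : 0 < t) :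
    IntegrableOn (fun u => h u * extensionKernel j t u) (Ioc 0 1) := by
  obtain ⟨C, hC⟩ := exists_extensionKernel_le j ht
  refine IntegrableOn.of_bound (C := M * C) (by simp)
    ((aestronglyMeasurable_mul_extensionKernel hc j t).mono_set Ioc_subset_Ioi_self)
    (ae_restrict_of_forall_mem measurableSet_Ioc fun u hu => ?_)
  rw [norm_mul, Real.norm_of_nonneg (extensionKernel_nonneg j t hu.1)]
  exact mul_le_mul (hM u hu.1) (hC u hu.1) (extensionKernel_nonneg j t hu.1)
    ((abs_nonneg _).trans (hM u hu.1))

namespace IsAdmissible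

variable {h : ℝ → ℝ} (hh : IsAdmissible h)
include hh

lemma integrableOn_mul_extensionKernel {j : ℕ} (hj : 1 ≤ j) {t : ℝ} (ht : 0 < t) :
    IntegrableOn (fun u => h u * extensionKernel j t u) (Ioi 0) := by
  obtain ⟨M, hM⟩ := hh.bounded
  rw [← Ioc_union_Ioi_eq_Ioi zero_le_one]
  refine (integrableOn_mul_extensionKernel_Ioc hh.continuousOn hM j ht).union
    (Integrable.mono hh.integrableOn_div
      ((aestronglyMeasurable_mul_extensionKernel hh.continuousOn j t).mono_set
        (Ioi_subset_Ioi zero_le_one))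
      (ae_restrict_of_forall_mem measurableSet_Ioi fun u hu => ?_))
  have hu₀ : 0 < u := zero_lt_one.trans hu
  rw [norm_mul, Real.norm_of_nonneg (extensionKernel_nonneg j t hu₀), div_eq_mul_inv, norm_mul,
    Real.norm_of_nonneg (inv_nonneg.2 hu₀.le)]
  gcongr
  calc extensionKernel j t u ≤ (u ^ j)⁻¹ := extensionKernel_le_inv_pow j t hu₀
    _ ≤ u⁻¹ := by
      gcongr
      exact le_self_pow₀ hu.le (by omega)

lemma hasDerivAt_integral {j : ℕ} (hj : 1 ≤ j) {t : ℝ} (ht : 0 < t) :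
    HasDerivAt (fun s => ∫ u in Ioi 0, h u * extensionKernel j s u)
      (-(t / 2) * ∫ u in Ioi 0, h u * extensionKernel (j + 1) t u) t := by
  have hmeas := aestronglyMeasurable_mul_extensionKernel hh.continuousOn
  have hderiv := hasDerivAt_integral_of_dominated_loc_of_deriv_le
    (μ := volume.restrict (Ioi 0)) (x₀ := t) (s := Ioo (t / 2) (2 * t))
    (F := fun s u => h u * extensionKernel j s u)
    (F' := fun s u => -(s / 2) * (h u * extensionKernel (j + 1) s u))
    (bound := fun u => t * ‖h u * extensionKernel (j + 1) (t / 2) u‖)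
    (Ioo_mem_nhds (by linarith) (by linarith)) (Eventually.of_forall fun s => hmeas j s)
    (hh.integrableOn_mul_extensionKernel hj ht) ((hmeas (j + 1) t).const_mul _)
    (ae_restrict_of_forall_mem measurableSet_Ioi fun u hu s hs => ?_)
    ((hh.integrableOn_mul_extensionKernel (by omega) (half_pos ht)).norm.const_mul t)
    (ae_of_all _ fun u s _ =>
      ((hasDerivAt_extensionKernel_left j s u).const_mul (h u)).congr_deriv (by ring))
  · simpa only [integral_const_mul] using hderiv.2
  · have hs₀ : 0 < s := (half_pos ht).trans hs.1
    rw [norm_mul, norm_mul (h u), norm_mul (h u), norm_neg, Real.norm_of_nonneg (half_pos hs₀).le,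
      Real.norm_of_nonneg (extensionKernel_nonneg _ _ hu),
      Real.norm_of_nonneg (extensionKernel_nonneg _ _ hu)]
    have hst : s / 2 ≤ t := by linarith [hs.2]
    have hk := extensionKernel_nonneg (j + 1) s hu
    gcongr
    exact extensionKernel_anti (j + 1) hu (half_pos ht).le hs.1.le

lemma tendsto_integral_atTop :
    Tendsto (fun t => ∫ u in Ioi 0, h u * extensionKernel 1 t u) atTop (𝓝 0) := by
  suffices Tendsto (fun t => ∫ u in Ioi 0, h u * extensionKernel 1 t u) atTop
      (𝓝 (∫ _ in Ioi (0 : ℝ), 0)) by simpa only [integral_zero]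
  refine tendsto_integral_filter_of_dominated_convergence (fun u => ‖h u * extensionKernel 1 1 u‖)
    (Eventually.of_forall (aestronglyMeasurable_mul_extensionKernel hh.continuousOn 1))
    ((eventually_ge_atTop 1).mono fun t ht =>
      ae_restrict_of_forall_mem measurableSet_Ioi fun u hu => ?_)
    (hh.integrableOn_mul_extensionKernel le_rfl one_pos).norm
    (ae_restrict_of_forall_mem measurableSet_Ioi fun u hu => ?_)
  · rw [norm_mul, norm_mul, Real.norm_of_nonneg (extensionKernel_nonneg 1 t hu),
      Real.norm_of_nonneg (extensionKernel_nonneg 1 1 hu)]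
    gcongr
    exact extensionKernel_anti 1 hu zero_le_one ht
  · have hquad : Tendsto (fun t : ℝ => t ^ 2 / (4 * u)) atTop atTop :=
      (tendsto_pow_atTop two_ne_zero).atTop_div_const (mul_pos four_pos hu)
    simpa [extensionKernel] using
      ((Real.tendsto_exp_neg_atTop_nhds_zero.comp hquad).div_const u).const_mul (h u)

lemma tendsto_mul_extensionKernel_one_zero {t : ℝ} (ht : 0 < t) :
    Tendsto (fun u => h u * extensionKernel 1 t u) (𝓝[>] 0) (𝓝 0) := by
  obtain ⟨M, hM⟩ := hh.bounded
  obtain ⟨C, hC⟩ := exists_extensionKernel_le 2 ht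
  have hlim : Tendsto (fun u : ℝ => M * (u * C)) (𝓝[>] 0) (𝓝 0) :=
    (Continuous.tendsto' (by fun_prop) 0 0 (by simp)).mono_left nhdsWithin_le_nhds
  refine squeeze_zero_norm' (eventually_mem_nhdsWithin.mono fun u (hu : 0 < u) => ?_) hlim
  rw [extensionKernel_eq_mul_succ 1 t hu, norm_mul, norm_mul u, Real.norm_of_nonneg hu.le,
    Real.norm_of_nonneg (extensionKernel_nonneg 2 t hu)]
  exact mul_le_mul (hM u hu) (mul_le_mul_of_nonneg_left (hC u hu) hu.le)
    (mul_nonneg hu.le (extensionKernel_nonneg 2 t hu)) ((abs_nonneg _).trans (hM u hu))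

lemma tendsto_mul_extensionKernel_one_atTop (t : ℝ) :
    Tendsto (fun u => h u * extensionKernel 1 t u) atTop (𝓝 0) := by
  obtain ⟨M, hM⟩ := hh.bounded
  have hlim : Tendsto (fun u : ℝ => M * u⁻¹) atTop (𝓝 0) := by
    simpa using tendsto_inv_atTop_zero.const_mul M
  refine squeeze_zero_norm' ((eventually_gt_atTop 0).mono fun u hu => ?_) hlim
  rw [norm_mul, Real.norm_of_nonneg (extensionKernel_nonneg 1 t hu)]
  exact mul_le_mul (hM u hu) (extensionKernel_one_le_inv t hu) (extensionKernel_nonneg 1 t hu)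
    ((abs_nonneg _).trans (hM u hu))

lemma integral_deriv_mul_extensionKernel {h' : ℝ → ℝ} (hd : ∀ u, 0 < u → HasDerivAt h (h' u) u)
    {t : ℝ} (ht : 0 < t) (hi : IntegrableOn (fun u => h' u * extensionKernel 1 t u) (Ioi 0)) :
    ∫ u in Ioi 0, h' u * extensionKernel 1 t u = (∫ u in Ioi 0, h u * extensionKernel 2 t u)
      - t ^ 2 / 4 * ∫ u in Ioi 0, h u * extensionKernel 3 t u := by
  have hi₂ := hh.integrableOn_mul_extensionKernel one_le_two ht
  have hi₃ := (hh.integrableOn_mul_extensionKernel (j := 3) (by norm_num) ht).const_mul (t ^ 2 / 4)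
  have hsplit : ∀ u, h u * (-extensionKernel 2 t u + t ^ 2 / 4 * extensionKernel 3 t u) =
      -(h u * extensionKernel 2 t u - t ^ 2 / 4 * (h u * extensionKernel 3 t u)) := fun u => by
    ring
  have hibp := integral_Ioi_mul_deriv_eq_deriv_mul (a := 0) (a' := 0) (b' := 0) hd
    (fun u hu => hasDerivAt_extensionKernel_one t hu)
    (((hi₂.sub hi₃).neg).congr (ae_of_all _ fun u => (hsplit u).symm)) hi
    (hh.tendsto_mul_extensionKernel_one_zero ht) (hh.tendsto_mul_extensionKernel_one_atTop t)
  simp only [hsplit, integral_neg, integral_sub hi₂ hi₃, integral_const_mul] at hibp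
  linarith

end IsAdmissible

/-! ### Behaviour as `t → 0` -/

lemma integral_image_const_div {c : ℝ} (hc : 0 ≤ c) {s : Set ℝ} (hs : MeasurableSet s)
    (hpos : s ⊆ Ioi 0) (g : ℝ → ℝ) :
    ∫ v in (c / ·) '' s, g v = ∫ u in s, c / u ^ 2 * g (c / u) := by
  have h := integral_image_eq_integral_deriv_smul_of_antitoneOn hs
    (fun u hu => (hasDerivAt_const_div c (hpos hu).ne').hasDerivWithinAt)
    (fun u hu _ _ huv => div_le_div_of_nonneg_left hc (hpos hu) huv) g
  simpa only [neg_neg, smul_eq_mul] using h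

lemma image_const_div_Ioi {c : ℝ} (hc : 0 < c) : (c / ·) '' Ioi 0 = Ioi 0 := by
  ext v
  refine ⟨?_, fun hv => ⟨c / v, div_pos hc hv, div_div_cancel₀ hc.ne'⟩⟩
  rintro ⟨u, hu, rfl⟩
  exact div_pos hc hu

lemma image_const_div_Ioc {c : ℝ} (hc : 0 < c) : (c / ·) '' Ioc 0 1 = Ici c := by
  ext v
  refine ⟨?_, fun hv => ⟨c / v, ⟨div_pos hc (hc.trans_le hv), div_le_one_of_le₀ hv
    (hc.le.trans hv)⟩, div_div_cancel₀ hc.ne'⟩⟩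
  rintro ⟨u, hu, rfl⟩
  exact le_div_self hc.le hu.1 hu.2

lemma tendsto_sq_div_four : Tendsto (fun t : ℝ => t ^ 2 / 4) (𝓝[>] 0) (𝓝[>] 0) :=
  tendsto_nhdsWithin_iff.2
    ⟨(Continuous.tendsto' (by fun_prop) 0 0 (by simp)).mono_left nhdsWithin_le_nhds,
      eventually_mem_nhdsWithin.mono fun t (ht : 0 < t) => mem_Ioi.2 (by positivity)⟩

lemma sq_mul_integral_mul_extensionKernel_two (h : ℝ → ℝ) {t : ℝ} (ht : 0 < t) :
    t ^ 2 * ∫ u in Ioi 0, h u * extensionKernel 2 t u =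
      4 * ∫ v in Ioi 0, h (t ^ 2 / 4 / v) * Real.exp (-v) := by
  have hc : 0 < t ^ 2 / 4 := by positivity
  have hcov := integral_image_const_div hc.le measurableSet_Ioi subset_rfl
    fun v => h (t ^ 2 / 4 / v) * Real.exp (-v)
  rw [image_const_div_Ioi hc] at hcov
  rw [hcov, ← integral_const_mul, ← integral_const_mul]
  refine setIntegral_congr_fun measurableSet_Ioi fun u _ => ?_
  simp only [div_div_cancel₀ hc.ne']
  rw [extensionKernel, div_div _ 4 u]
  ring

lemma tendsto_integral_comp_div_mul_exp_neg {h : ℝ → ℝ} {M a : ℝ} (hc : ContinuousOn h (Ioi 0))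
    (hM : ∀ u, 0 < u → |h u| ≤ M) (ha : Tendsto h (𝓝[>] 0) (𝓝 a)) :
    Tendsto (fun x : ℝ => ∫ v in Ioi 0, h (x / v) * Real.exp (-v)) (𝓝[>] 0) (𝓝 a) := by
  have hint : ∫ v in Ioi (0 : ℝ), a * Real.exp (-v) = a := by
    rw [integral_const_mul, integral_exp_neg_Ioi_zero, mul_one]
  rw [← hint]
  refine tendsto_integral_filter_of_dominated_convergence (fun v => M * Real.exp (-v))
    (eventually_mem_nhdsWithin.mono fun x (hx : 0 < x) => ?_)
    (eventually_mem_nhdsWithin.mono fun x (hx : 0 < x) =>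
      ae_restrict_of_forall_mem measurableSet_Ioi fun v (hv : 0 < v) => ?_)
    ((integrableOn_exp_neg_Ioi 0).const_mul M)
    (ae_restrict_of_forall_mem measurableSet_Ioi fun v (hv : 0 < v) => ?_)
  · have hdiv : ContinuousOn (fun v : ℝ => x / v) (Ioi 0) :=
      continuousOn_const.div continuousOn_id fun v hv => hv.ne'
    exact ((hc.comp hdiv fun v hv => div_pos hx hv).mul
      (by fun_prop)).aestronglyMeasurable measurableSet_Ioi
  · rw [norm_mul, Real.norm_of_nonneg (Real.exp_pos _).le]
    gcongr
    exact hM _ (div_pos hx hv)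
  · have hdiv : Tendsto (fun x : ℝ => x / v) (𝓝[>] 0) (𝓝[>] 0) := tendsto_nhdsWithin_iff.2
      ⟨(Continuous.tendsto' (by fun_prop) 0 0 (zero_div v)).mono_left nhdsWithin_le_nhds,
        eventually_mem_nhdsWithin.mono fun x hx => div_pos hx hv⟩
    exact (ha.comp hdiv).mul_const _

lemma tendsto_sq_mul_integral_mul_extensionKernel_two {h : ℝ → ℝ} {M a : ℝ}
    (hc : ContinuousOn h (Ioi 0)) (hM : ∀ u, 0 < u → |h u| ≤ M) (ha : Tendsto h (𝓝[>] 0) (𝓝 a)) :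
    Tendsto (fun t => t ^ 2 * ∫ u in Ioi 0, h u * extensionKernel 2 t u) (𝓝[>] 0)
      (𝓝 (4 * a)) :=
  (((tendsto_integral_comp_div_mul_exp_neg hc hM ha).comp tendsto_sq_div_four).const_mul 4).congr'
    (eventually_mem_nhdsWithin.mono fun _ ht =>
      (sq_mul_integral_mul_extensionKernel_two h ht).symm)

lemma tendsto_setIntegral_mul_extensionKernel_one {h : ℝ → ℝ} {s : Set ℝ} (hs : MeasurableSet s)
    (hpos : s ⊆ Ioi 0) (hc : ContinuousOn h (Ioi 0)) (hi : IntegrableOn (fun u => h u / u) s) :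
    Tendsto (fun t => ∫ u in s, h u * extensionKernel 1 t u) (𝓝[>] 0)
      (𝓝 (∫ u in s, h u / u)) := by
  refine tendsto_integral_filter_of_dominated_convergence (fun u => ‖h u / u‖)
    (Eventually.of_forall fun t =>
      (aestronglyMeasurable_mul_extensionKernel hc 1 t).mono_set hpos)
    (Eventually.of_forall fun t => ae_restrict_of_forall_mem hs fun u hu => ?_) hi.norm
    (ae_restrict_of_forall_mem hs fun u _ => ?_)
  · have hu₀ : 0 < u := hpos hu
    rw [norm_mul, Real.norm_of_nonneg (extensionKernel_nonneg 1 t hu₀), div_eq_mul_inv, norm_mul,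
      Real.norm_of_nonneg (inv_nonneg.2 hu₀.le)]
    gcongr
    exact extensionKernel_one_le_inv t hu₀
  · have hcont : ContinuousAt (fun t => h u * extensionKernel 1 t u) 0 :=
      (hasDerivAt_extensionKernel_left 1 0 u).continuousAt.const_mul _
    have hzero : h u * extensionKernel 1 0 u = h u / u := by
      simp [extensionKernel, div_eq_mul_inv]
    exact hzero ▸ hcont.tendsto.mono_left nhdsWithin_le_nhds

lemma integral_extensionKernel_one_Ioc {t : ℝ} (ht : 0 < t) :
    ∫ u in Ioc 0 1, extensionKernel 1 t u = ∫ v in Ioi (t ^ 2 / 4), Real.exp (-v) / v := by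
  have hc : 0 < t ^ 2 / 4 := by positivity
  rw [← integral_Ici_eq_integral_Ioi, ← image_const_div_Ioc hc,
    integral_image_const_div hc.le measurableSet_Ioc Ioc_subset_Ioi_self]
  refine setIntegral_congr_fun measurableSet_Ioc fun u hu => ?_
  have hu₀ := hu.1
  simp only [extensionKernel, div_div]
  field_simp

/-! ### The logarithmic singularity -/

lemma integrableOn_exp_neg_div {x : ℝ} (hx : 0 < x) :
    IntegrableOn (fun v : ℝ => Real.exp (-v) / v) (Ioi x) := by
  refine ((integrableOn_exp_neg_Ioi x).mul_const x⁻¹).mono'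
    (Measurable.aestronglyMeasurable (by fun_prop))
    (ae_restrict_of_forall_mem measurableSet_Ioi fun v (hv : x < v) => ?_)
  have hv₀ : 0 < v := hx.trans hv
  rw [Real.norm_of_nonneg (by positivity), div_eq_mul_inv]
  gcongr

lemma norm_one_sub_exp_neg_div_le {v : ℝ} (hv : 0 < v) : ‖(1 - Real.exp (-v)) / v‖ ≤ 1 := by
  have hlower := Real.add_one_le_exp (-v)
  have hupper : Real.exp (-v) ≤ 1 := Real.exp_le_one_iff.2 (neg_nonpos.2 hv.le)
  rw [Real.norm_of_nonneg (div_nonneg (sub_nonneg.2 hupper) hv.le), div_le_one hv]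
  linarith

lemma intervalIntegrable_one_sub_exp_neg_div {a b : ℝ} (ha : 0 ≤ a) (hab : a ≤ b) :
    IntervalIntegrable (fun v : ℝ => (1 - Real.exp (-v)) / v) volume a b := by
  rw [intervalIntegrable_iff_integrableOn_Ioc_of_le hab]
  exact IntegrableOn.of_bound (C := 1) (by simp) (Measurable.aestronglyMeasurable (by fun_prop))
    (ae_restrict_of_forall_mem measurableSet_Ioc fun v hv =>
      norm_one_sub_exp_neg_div_le (ha.trans_lt hv.1))

lemma integral_exp_neg_div_Ioi_add_log {x b : ℝ} (hx : 0 < x) (hxb : x ≤ b) :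
    (∫ v in Ioi x, Real.exp (-v) / v) + Real.log x = (∫ v in Ioi b, Real.exp (-v) / v)
      + Real.log b - ∫ v in x..b, (1 - Real.exp (-v)) / v := by
  have hb := hx.trans_le hxb
  have hi := integrableOn_exp_neg_div hx
  have hsplit : ∫ v in Ioi x, Real.exp (-v) / v =
      (∫ v in x..b, Real.exp (-v) / v) + ∫ v in Ioi b, Real.exp (-v) / v := by
    rw [intervalIntegral.integral_of_le hxb, ← setIntegral_union (Ioc_disjoint_Ioi le_rfl)
      measurableSet_Ioi (hi.mono_set Ioc_subset_Ioi_self) (hi.mono_set (Ioi_subset_Ioi hxb)),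
      Ioc_union_Ioi_eq_Ioi hxb]
  have hinv : IntervalIntegrable (fun v : ℝ => 1 / v) volume x b :=
    intervalIntegral.intervalIntegrable_one_div
      (fun v hv => ((lt_min hx hb).trans_le hv.1).ne') continuousOn_id
  have hsub : ∫ v in x..b, Real.exp (-v) / v =
      Real.log (b / x) - ∫ v in x..b, (1 - Real.exp (-v)) / v := by
    rw [← integral_one_div_of_pos hx hb, ← intervalIntegral.integral_sub hinv
      (intervalIntegrable_one_sub_exp_neg_div hx.le hxb)]
    simp only [← sub_div, sub_sub_cancel]
  rw [hsplit, hsub, Real.log_div hb.ne' hx.ne']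
  ring

lemma tendsto_integral_exp_neg_div_add_log {b : ℝ} (hb : 0 < b) :
    Tendsto (fun x => (∫ v in Ioi x, Real.exp (-v) / v) + Real.log x) (𝓝[>] 0)
      (𝓝 ((∫ v in Ioi b, Real.exp (-v) / v) + Real.log b
        - ∫ v in Ioc 0 b, (1 - Real.exp (-v)) / v)) := by
  have hcont : ContinuousOn (fun x => ∫ v in x..b, (1 - Real.exp (-v)) / v) (Icc 0 b) := by
    rw [← uIcc_of_le hb.le]
    exact intervalIntegral.continuousOn_primitive_interval_left
      ((intervalIntegrable_iff' (by simp)).1 (intervalIntegrable_one_sub_exp_neg_div le_rfl hb.le))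
  have hlim : Tendsto (fun x => ∫ v in x..b, (1 - Real.exp (-v)) / v) (𝓝[>] 0)
      (𝓝 (∫ v in (0 : ℝ)..b, (1 - Real.exp (-v)) / v)) :=
    (hcont 0 (left_mem_Icc.2 hb.le)).mono_left
      (nhdsWithin_le_iff.2 (mem_of_superset (Ioc_mem_nhdsGT hb) Ioc_subset_Icc_self))
  rw [intervalIntegral.integral_of_le hb.le] at hlim
  exact (hlim.const_sub _).congr' ((eventually_mem_set.2 (Ioc_mem_nhdsGT hb)).mono fun x hx =>
    (integral_exp_neg_div_Ioi_add_log hx.1 hx.2).symm)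

lemma tendsto_integral_extensionKernel_one_add_log :
    Tendsto (fun t => (∫ u in Ioc 0 1, extensionKernel 1 t u) + 2 * Real.log t) (𝓝[>] 0)
      (𝓝 (constK + Real.eulerMascheroniConstant)) := by
  have hlim := ((tendsto_integral_exp_neg_div_add_log (b := 1 / 4) (by norm_num)).comp
    tendsto_sq_div_four).add_const (Real.log 4)
  have hval : constK + Real.eulerMascheroniConstant =
      (∫ v in Ioi (1 / 4 : ℝ), Real.exp (-v) / v) + Real.log (1 / 4)
        - (∫ v in Ioc 0 (1 / 4 : ℝ), (1 - Real.exp (-v)) / v) + Real.log 4 := by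
    rw [constK, one_div, Real.log_inv]
    ring
  rw [hval]
  refine hlim.congr' (eventually_mem_nhdsWithin.mono fun t (ht : 0 < t) => ?_)
  simp only [Function.comp_apply]
  rw [integral_extensionKernel_one_Ioc ht, Real.log_div (by positivity) four_ne_zero, Real.log_pow]
  push_cast
  ring

lemma IsAdmissible.tendsto_integral_add_log {h : ℝ → ℝ} (hh : IsAdmissible h) {D a : ℝ}
    (hD : ∀ u, 0 < u → |h u - a| ≤ D * u) :
    Tendsto (fun t => (∫ u in Ioi 0, h u * extensionKernel 1 t u) + 2 * a * Real.log t) (𝓝[>] 0)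
      (𝓝 ((∫ u in Ioc 0 1, (h u - a) / u) + (∫ u in Ioi 1, h u / u)
        + a * (constK + Real.eulerMascheroniConstant))) := by
  have hc : ContinuousOn (fun u => h u - a) (Ioi 0) := hh.continuousOn.sub continuousOn_const
  have hnear := tendsto_setIntegral_mul_extensionKernel_one measurableSet_Ioc Ioc_subset_Ioi_self
    hc (integrableOn_div_Ioc_of_abs_le hc hD)
  have hfar := tendsto_setIntegral_mul_extensionKernel_one measurableSet_Ioi
    (Ioi_subset_Ioi zero_le_one) hh.continuousOn hh.integrableOn_div
  refine ((hnear.add hfar).add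
    (tendsto_integral_extensionKernel_one_add_log.const_mul a)).congr'
    (eventually_mem_nhdsWithin.mono fun t (ht : 0 < t) => ?_)
  have hi := hh.integrableOn_mul_extensionKernel le_rfl ht
  have hi_one : IntegrableOn (fun u => a * extensionKernel 1 t u) (Ioc 0 1) :=
    integrableOn_mul_extensionKernel_Ioc continuousOn_const (fun _ _ => le_rfl) 1 ht
  simp only [sub_mul]
  rw [integral_sub (hi.mono_set Ioc_subset_Ioi_self) hi_one, integral_const_mul,
    ← Ioc_union_Ioi_eq_Ioi (zero_le_one' ℝ), setIntegral_union (Ioc_disjoint_Ioi le_rfl)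
    measurableSet_Ioi (hi.mono_set Ioc_subset_Ioi_self)
    (hi.mono_set (Ioi_subset_Ioi zero_le_one))]
  ring

/-! ### The extension -/

lemma extensionIntegrand_eq (f : ℤ → ℝ) (n : ℤ) (t : ℝ) :
    extensionIntegrand f n t = fun u => heat u f n * extensionKernel 1 t u := by
  funext u
  rw [extensionIntegrand, extensionKernel, pow_one]

lemma extension_eq (f : ℤ → ℝ) (n : ℤ) :
    extension f n = fun t => ∫ u in Ioi 0, heat u f n * extensionKernel 1 t u := by
  funext t
  rw [extension, extensionIntegrand_eq]

section ModerateGrowth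

variable {f : ℤ → ℝ} (hf : Summable fun m : ℤ => |f m| / (1 + |(m : ℝ)|))
include hf

lemma isAdmissible_heat (n : ℤ) : IsAdmissible fun u => heat u f n where
  continuousOn := continuousOn_heat hf n
  bounded := exists_abs_heat_le hf n
  integrableOn_div := integrableOn_heat_div_Ioi hf n

lemma integrableOn_extensionIntegrand (n : ℤ) {t : ℝ} (ht : 0 < t) :
    IntegrableOn (extensionIntegrand f n t) (Ioi 0) :=
  extensionIntegrand_eq f n t ▸ (isAdmissible_heat hf n).integrableOn_mul_extensionKernel le_rfl ht

lemma tendsto_extension_atTop (n : ℤ) : Tendsto (extension f n) atTop (𝓝 0) :=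
  extension_eq f n ▸ (isAdmissible_heat hf n).tendsto_integral_atTop

lemma hasDerivAt_extension (n : ℤ) {t : ℝ} (ht : 0 < t) :
    HasDerivAt (extension f n)
      (-(t / 2) * ∫ u in Ioi 0, heat u f n * extensionKernel 2 t u) t :=
  extension_eq f n ▸ (isAdmissible_heat hf n).hasDerivAt_integral le_rfl ht

lemma hasDerivAt_deriv_extension (n : ℤ) {t : ℝ} (ht : 0 < t) :
    HasDerivAt (deriv (extension f n))
      (-(1 / 2) * (∫ u in Ioi 0, heat u f n * extensionKernel 2 t u)
        + t ^ 2 / 4 * ∫ u in Ioi 0, heat u f n * extensionKernel 3 t u) t := by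
  have hprod := ((hasDerivAt_id t).div_const 2).neg.mul
    ((isAdmissible_heat hf n).hasDerivAt_integral one_le_two ht)
  refine (hprod.congr_deriv ?_).congr_of_eventuallyEq ?_
  · simp only [Pi.neg_apply, id]
    ring
  · filter_upwards [Ioi_mem_nhds ht] with s hs
    exact (hasDerivAt_extension hf n hs).deriv

omit hf in
lemma discreteLaplacian_heat_mul_extensionKernel (n : ℤ) (t u : ℝ) :
    discreteLaplacian (heat u f) n * extensionKernel 1 t u =
      heat u f (n + 1) * extensionKernel 1 t u - 2 * (heat u f n * extensionKernel 1 t u)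
        + heat u f (n - 1) * extensionKernel 1 t u := by
  rw [discreteLaplacian]
  ring

lemma integrableOn_discreteLaplacian_heat_mul (n : ℤ) {t : ℝ} (ht : 0 < t) :
    IntegrableOn (fun u => discreteLaplacian (heat u f) n * extensionKernel 1 t u) (Ioi 0) := by
  have hi (k : ℤ) := (isAdmissible_heat hf k).integrableOn_mul_extensionKernel le_rfl ht
  simp only [discreteLaplacian_heat_mul_extensionKernel]
  exact ((hi (n + 1)).sub ((hi n).const_mul 2)).add (hi (n - 1))

lemma integral_discreteLaplacian_heat_mul (n : ℤ) {t : ℝ} (ht : 0 < t) :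
    ∫ u in Ioi 0, discreteLaplacian (heat u f) n * extensionKernel 1 t u =
      discreteLaplacian (fun k => extension f k t) n := by
  have hi (k : ℤ) := (isAdmissible_heat hf k).integrableOn_mul_extensionKernel le_rfl ht
  have hsub : IntegrableOn (fun u => heat u f (n + 1) * extensionKernel 1 t u
      - 2 * (heat u f n * extensionKernel 1 t u)) (Ioi 0) :=
    (hi (n + 1)).sub ((hi n).const_mul 2)
  simp only [discreteLaplacian_heat_mul_extensionKernel]
  rw [integral_add hsub (hi (n - 1)), integral_sub (hi (n + 1)) ((hi n).const_mul 2),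
    integral_const_mul]
  simp only [discreteLaplacian, extension_eq]

lemma deriv_deriv_extension_add (n : ℤ) {t : ℝ} (ht : 0 < t) :
    deriv (deriv (extension f n)) t + (1 / t) * deriv (extension f n) t
      + discreteLaplacian (fun k => extension f k t) n = 0 := by
  rw [(hasDerivAt_deriv_extension hf n ht).deriv, (hasDerivAt_extension hf n ht).deriv,
    ← integral_discreteLaplacian_heat_mul hf n ht,
    (isAdmissible_heat hf n).integral_deriv_mul_extensionKernel
      (fun u hu => hasDerivAt_heat hf hu n) ht (integrableOn_discreteLaplacian_heat_mul hf n ht)]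
  field_simp
  ring

lemma tendsto_mul_deriv_extension (n : ℤ) :
    Tendsto (fun t => t * deriv (extension f n) t) (𝓝[>] 0) (𝓝 (-2 * f n)) := by
  obtain ⟨M, hM⟩ := exists_abs_heat_le hf n
  have hlim := (tendsto_sq_mul_integral_mul_extensionKernel_two (continuousOn_heat hf n) hM
    (tendsto_heat_zero hf n)).const_mul (-(1 / 2))
  rw [show -(1 / 2) * (4 * f n) = -2 * f n by ring] at hlim
  refine hlim.congr' (eventually_mem_nhdsWithin.mono fun t ht => ?_)
  beta_reduce
  rw [(hasDerivAt_extension hf n ht).deriv]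
  ring

lemma tendsto_extension_add_log (n : ℤ) :
    Tendsto (fun t => extension f n t + 2 * f n * Real.log t) (𝓝[>] 0)
      (𝓝 (f n * constK - logDiscreteLaplacian f n)) := by
  obtain ⟨D, hD⟩ := exists_abs_heat_sub_le hf n
  have hvalue : f n * constK - logDiscreteLaplacian f n =
      (∫ u in Ioc 0 1, (heat u f n - f n) / u) + (∫ u in Ioi 1, heat u f n / u)
        + f n * (constK + Real.eulerMascheroniConstant) := by
    rw [logDiscreteLaplacian_eq_integral hf]
    ring
  rw [hvalue, extension_eq]
  exact (isAdmissible_heat hf n).tendsto_integral_add_log hD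

lemma tendsto_extension_div_log (n : ℤ) :
    Tendsto (fun t => extension f n t / Real.log t) (𝓝[>] 0) (𝓝 (-2 * f n)) := by
  have hlim := ((tendsto_extension_add_log hf n).div_atBot
    Real.tendsto_log_nhdsGT_zero).sub_const (2 * f n)
  rw [zero_sub, ← neg_mul] at hlim
  refine hlim.congr' ((eventually_mem_set.2 (Ioo_mem_nhdsGT one_pos)).mono fun t ht => ?_)
  have hlog : Real.log t ≠ 0 := (Real.log_neg ht.1 ht.2).ne
  field_simp
  ring

end ModerateGrowth

lemma summable_div_one_add_abs_of_sqrt {f : ℤ → ℝ}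
    (hf : Summable fun m : ℤ => |f m| / Real.sqrt (1 + |(m : ℝ)|)) :
    Summable fun m : ℤ => |f m| / (1 + |(m : ℝ)|) := by
  refine hf.of_nonneg_of_le (fun m => by positivity) fun m => ?_
  gcongr
  exact Real.sqrt_le_self_iff.2 (.inr (le_add_of_nonneg_right (abs_nonneg _)))

end DiscreteLog

/-- The weight `1 / (1 + |m|)` is the natural one, as `W_∞(m)` decays no faster than `1 / |m|`. -/
theorem theorem1p2_general (f : ℤ → ℝ) (hf : Summable fun m : ℤ => |f m| / (1 + |(m : ℝ)|)) :
    (∀ (n : ℤ) (u : ℝ), 0 < u →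
        Summable (fun m : ℤ => DiscreteLog.heatKernel u (n - m) * f m)) ∧
    (∀ (n : ℤ) (t : ℝ), 0 < t →
        IntegrableOn (DiscreteLog.extensionIntegrand f n t) (Ioi 0)) ∧
    (∀ m : ℤ, m ≠ 0 →
        IntegrableOn (fun t : ℝ => DiscreteLog.heatKernel t m / t) (Ioc 0 1)) ∧
    (∀ m : ℤ, IntegrableOn (fun t : ℝ => DiscreteLog.heatKernel t m / t) (Ioi 1)) ∧
    (∀ n : ℤ, Summable
        (fun m : {m : ℤ // m ≠ n} => DiscreteLog.kernelZero (n - m) * (f n - f m))) ∧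
    (∀ n : ℤ, Summable (fun m : ℤ => DiscreteLog.kernelInfty (n - m) * f m)) ∧
    (∀ n : ℤ, Tendsto (fun t : ℝ => DiscreteLog.extension f n t) atTop (𝓝 0)) ∧
    (∀ (n : ℤ) (t : ℝ), 0 < t →
        DifferentiableAt ℝ (DiscreteLog.extension f n) t ∧
        DifferentiableAt ℝ (deriv (DiscreteLog.extension f n)) t ∧
        deriv (deriv (DiscreteLog.extension f n)) t
          + (1 / t) * deriv (DiscreteLog.extension f n) t
          + DiscreteLog.discreteLaplacian (fun k : ℤ => DiscreteLog.extension f k t) n = 0) ∧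
    (∀ n : ℤ, Tendsto (fun t : ℝ => t * deriv (DiscreteLog.extension f n) t)
        (𝓝[>] 0) (𝓝 (-2 * f n))) ∧
    (∀ n : ℤ, Tendsto (fun t : ℝ => DiscreteLog.extension f n t / Real.log t)
        (𝓝[>] 0) (𝓝 (-2 * f n))) ∧
    (∀ n : ℤ, ∃ L : ℝ,
        Tendsto (fun t : ℝ => DiscreteLog.extension f n t + 2 * f n * Real.log t)
          (𝓝[>] 0) (𝓝 L) ∧
        DiscreteLog.logDiscreteLaplacian f n = -L + f n * DiscreteLog.constK) :=
  ⟨fun n _ hu => DiscreteLog.summable_heatKernel_mul hf hu n,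
    fun n _ ht => DiscreteLog.integrableOn_extensionIntegrand hf n ht,
    fun _ hm => DiscreteLog.integrableOn_heatKernel_div_Ioc hm,
    DiscreteLog.integrableOn_heatKernel_div_Ioi,
    fun n => (DiscreteLog.hasSum_kernelZero hf n).summable.subtype _,
    fun n => (DiscreteLog.hasSum_kernelInfty hf n).summable,
    DiscreteLog.tendsto_extension_atTop hf,
    fun n _ ht => ⟨(DiscreteLog.hasDerivAt_extension hf n ht).differentiableAt,
      (DiscreteLog.hasDerivAt_deriv_extension hf n ht).differentiableAt,
      DiscreteLog.deriv_deriv_extension_add hf n ht⟩,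
    DiscreteLog.tendsto_mul_deriv_extension hf,
    DiscreteLog.tendsto_extension_div_log hf,
    fun n => ⟨_, DiscreteLog.tendsto_extension_add_log hf n, by ring⟩⟩

/-- The first two groups of conjuncts say that the extension and `log(-Δ_d) f` are given by
convergent series and integrals; then come the five properties of the extension. -/
theorem theorem1p2 (f : ℤ → ℝ)
    (hf : Summable (fun m : ℤ => |f m| / Real.sqrt (1 + |(m : ℝ)|))) :
    -- the extension is well defined
    (∀ (n : ℤ) (u : ℝ), 0 < u →
        Summable (fun m : ℤ => DiscreteLog.heatKernel u (n - m) * f m)) ∧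
    (∀ (n : ℤ) (t : ℝ), 0 < t →
        IntegrableOn (DiscreteLog.extensionIntegrand f n t) (Ioi 0)) ∧
    -- the logarithmic discrete Laplacian of `f` is well defined
    (∀ m : ℤ, m ≠ 0 →
        IntegrableOn (fun t : ℝ => DiscreteLog.heatKernel t m / t) (Ioc 0 1)) ∧
    (∀ m : ℤ, IntegrableOn (fun t : ℝ => DiscreteLog.heatKernel t m / t) (Ioi 1)) ∧
    (∀ n : ℤ, Summable
        (fun m : {m : ℤ // m ≠ n} => DiscreteLog.kernelZero (n - m) * (f n - f m))) ∧
    (∀ n : ℤ, Summable (fun m : ℤ => DiscreteLog.kernelInfty (n - m) * f m)) ∧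
    -- (i)
    (∀ n : ℤ, Tendsto (fun t : ℝ => DiscreteLog.extension f n t) atTop (𝓝 0)) ∧
    -- (ii)
    (∀ (n : ℤ) (t : ℝ), 0 < t →
        DifferentiableAt ℝ (DiscreteLog.extension f n) t ∧
        DifferentiableAt ℝ (deriv (DiscreteLog.extension f n)) t ∧
        deriv (deriv (DiscreteLog.extension f n)) t
          + (1 / t) * deriv (DiscreteLog.extension f n) t
          + DiscreteLog.discreteLaplacian (fun k : ℤ => DiscreteLog.extension f k t) n = 0) ∧
    -- (iii)
    (∀ n : ℤ, Tendsto (fun t : ℝ => t * deriv (DiscreteLog.extension f n) t)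
        (𝓝[>] 0) (𝓝 (-2 * f n))) ∧
    -- (iv)
    (∀ n : ℤ, Tendsto (fun t : ℝ => DiscreteLog.extension f n t / Real.log t)
        (𝓝[>] 0) (𝓝 (-2 * f n))) ∧
    -- (v)
    (∀ n : ℤ, ∃ L : ℝ,
        Tendsto (fun t : ℝ => DiscreteLog.extension f n t + 2 * f n * Real.log t)
          (𝓝[>] 0) (𝓝 L) ∧
        DiscreteLog.logDiscreteLaplacian f n = -L + f n * DiscreteLog.constK) :=
  theorem1p2_general f (DiscreteLog.summable_div_one_add_abs_of_sqrt hf)
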